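/- Let $X\sim\mathcal N(0,\Sigma)$ be a Gaussian vector in $\mathbb R^L$ with $\Sigma\succ0$, and let $\Sigma=\Theta^T\operatorname{diag}(\lambda_1,\dots,\lambda_L)\,\Theta$ with $\Theta$ orthogonal. Let the perception loss $\phi(P_X,P_{\hat X})$ be either the Kullback–Leibler divergence $D(P_{\hat X}\|P_X)$ or the squared Wasserstein-2 distance $W_2^2(P_X,P_{\hat X})$, and let the rate-distortion-perception function be $$R(D,P)=\inf\bigl\{I(X;\hat X)\ :\ P_{\hat X|X}\text{ with }\mathbb E\|X-\hat X\|^2\le D,\ \phi(P_X,P_{\hat X})\le P\bigr\}$$ (mutual information in nats). Let $0<D<2\sum_{\ell=1}^L\lambda_\ell$. Then there is a $\nu_1>0$ such that $$D=\sum_{\ell=1}^L\Bigl[2\lambda_\ell-2\sqrt{\lambda_\ell(\lambda_\ell-\gamma^*_\ell)}\Bigr],\qquad \gamma^*_\ell=\frac{2\lambda_\ell}{1+\sqrt{1+16\nu_1^2\lambda_\ell^2}},$$ and for every such $\nu_1$, for both choices of $\phi$, $$R(D,0)=\frac12\sum_{\ell=1}^L\log\frac{1+\sqrt{1+16\nu_1^2\lambda_\ell^2}}{2}.$$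 Moreover, for both choices of $\phi$, the $\gamma^*_\ell$ are the optimal water levels at $P=0$: $(\gamma_\ell,\hat\lambda_\ell)=(\gamma^*_\ell,\lambda_\ell)$, $\ell=1,\dots,L$, is the unique minimizer of $\frac12\sum_\ell\log(\lambda_\ell/\gamma_\ell)$ subject to $0<\gamma_\ell\le\lambda_\ell$, $\hat\lambda_\ell\ge0$, $\sum_\ell\bigl(\lambda_\ell-2\sqrt{\hat\lambda_\ell(\lambda_\ell-\gamma_\ell)}+\hat\lambda_\ell\bigr)\le D$ and $\sum_\ell P_\ell(\hat\lambda_\ell)\le0$, where $P_\ell(\hat\lambda)=\frac12\bigl(\hat\lambda/\lambda_\ell-1+\log(\lambda_\ell/\hat\lambda)\bigr)$ (and $P_\ell(0)=\infty$) for the KL divergence, and $P_\ell(\hat\lambda)=(\sqrt{\lambda_\ell}-\sqrt{\hat\lambda})^2$ for the squared Wasserstein-2 distance. -/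

import Mathlib

open MeasureTheory ProbabilityTheory InformationTheory
open scoped ENNReal

noncomputable section

/-- The space `ℝ^L` with its Euclidean norm. -/
abbrev Vec (L : ℕ) : Type := EuclideanSpace ℝ (Fin L)

/-- Law of the reconstruction: the output distribution of the channel `κ = P_{X̂|X}` when the
input has law `μ = P_X`. -/
def reconLaw {L : ℕ} (μ : Measure (Vec L)) (κ : Kernel (Vec L) (Vec L)) : Measure (Vec L) :=
  (μ ⊗ₘ κ).snd

/-- Mutual information `I(X; X̂)`, in nats, of a source `X ∼ μ` and `X̂` obtained from `X`
through the channel `κ`: the Kullback-Leibler divergence of the joint law from the product of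
the marginals. -/
def mutualInformation {L : ℕ} (μ : Measure (Vec L)) (κ : Kernel (Vec L) (Vec L)) : ℝ≥0∞ :=
  klDiv (μ ⊗ₘ κ) (μ.prod (reconLaw μ κ))

/-- `E‖X - X̂‖²` for a joint law `π` of `(X, X̂)`. -/
def meanSquaredError {L : ℕ} (π : Measure (Vec L × Vec L)) : ℝ≥0∞ :=
  ∫⁻ p, ENNReal.ofReal (‖p.1 - p.2‖ ^ 2) ∂π

/-- The KL perception loss `φ(P_X, P_X̂) = D(P_X̂ ‖ P_X)`. -/
def klPerception {L : ℕ} (μ ν : Measure (Vec L)) : ℝ≥0∞ :=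
  klDiv ν μ

/-- The squared Wasserstein-2 distance `φ(P_X, P_X̂) = W₂²(P_X, P_X̂)`. -/
def wassersteinPerception {L : ℕ} (μ ν : Measure (Vec L)) : ℝ≥0∞ :=
  ⨅ (π : Measure (Vec L × Vec L)) (_ : π.fst = μ) (_ : π.snd = ν), meanSquaredError π

/-- The information rate-distortion-perception function `R(D, P)` of a source of law `μ` with
squared-error distortion and perception loss `φ` (infimum over conditional distributions of `X̂`
given `X`; its value is `∞` if no conditional distribution is admissible). -/
def rdpFunction {L : ℕ} (φ : Measure (Vec L) → Measure (Vec L) → ℝ≥0∞) (μ : Measure (Vec L))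
    (D P : ℝ≥0∞) : ℝ≥0∞ :=
  ⨅ (κ : Kernel (Vec L) (Vec L)) (_ : IsMarkovKernel κ)
    (_ : meanSquaredError (μ ⊗ₘ κ) ≤ D) (_ : φ μ (reconLaw μ κ) ≤ P), mutualInformation μ κ

/-- Distortion of a component of variance `l` that is reconstructed with variance `l'` and
water level (minimum mean-squared error) `g`. -/
def componentDistortion (l g l' : ℝ) : ℝ :=
  l - 2 * √(l' * (l - g)) + l'

/-- KL perception loss of a component of variance `l` that is reconstructed with variance `l'`.
It is infinite at `l' = 0`; for `l, l' > 0` the real expression is nonnegative. -/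
def componentKL (l l' : ℝ) : ℝ≥0∞ :=
  if l' = 0 then ∞ else ENNReal.ofReal ((l' / l - 1 + Real.log (l / l')) / 2)

/-- Squared Wasserstein-2 perception loss of a component of variance `l` that is reconstructed
with variance `l'`. -/
def componentW2 (l l' : ℝ) : ℝ≥0∞ :=
  ENNReal.ofReal ((√l - √l') ^ 2)

/-- Admissible pairs `(γ, l')` of water levels and reconstruction variances in the
water-filling program of a source with component variances `l`. -/
def programFeasible {L : ℕ} (p : ℝ → ℝ → ℝ≥0∞) (l : Fin L → ℝ) (D : ℝ) (P : ℝ≥0∞) :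
    Set ((Fin L → ℝ) × (Fin L → ℝ)) :=
  {x | (∀ i, 0 < x.1 i ∧ x.1 i ≤ l i) ∧ (∀ i, 0 ≤ x.2 i) ∧
    ∑ i, componentDistortion (l i) (x.1 i) (x.2 i) ≤ D ∧ ∑ i, p (l i) (x.2 i) ≤ P}

/-- The set of optimal solutions `(γ*(D, P), l'*(D, P))` of the water-filling program: the
minimizers of the rate `½ ∑ log (l / γ)` over the admissible pairs. -/
def programOptimal {L : ℕ} (p : ℝ → ℝ → ℝ≥0∞) (l : Fin L → ℝ) (D : ℝ) (P : ℝ≥0∞) :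
    Set ((Fin L → ℝ) × (Fin L → ℝ)) :=
  {x | x ∈ programFeasible p l D P ∧
    IsMinOn (fun y : (Fin L → ℝ) × (Fin L → ℝ) => (1 / 2 : ℝ) * ∑ i, Real.log (l i / y.1 i))
      (programFeasible p l D P) x}

/-- The water level `2λ / (1 + √(1 + 16 ν² λ²))`. -/
def waterLevel (ν l : ℝ) : ℝ :=
  2 * l / (1 + √(1 + 16 * ν ^ 2 * l ^ 2))

end

/-! At `P = 0` both perception losses force the reconstruction to have the source law, so only
couplings of `μ` with itself compete. In the coordinates `Θ x` the source has independent components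
of variances `l i`. With `r i = √(1 - γ* i / l i)`, the definition of the water level is equivalent
to `r i / (1 - r i ^ 2) = 2 * ν * l i` (`waterCorr_eq`), the stationarity condition with one
multiplier shared by all components.

Let `F` be the log-density, relative to `μ.prod μ`, of the Gaussian coupling with correlations `r
i`. The shared multiplier makes `F` a sum of functions of `x` and of `y` alone, minus `ν * ‖x - y‖ ^
2`. Hence its integral under a coupling of `μ` with itself depends only on the mean squared error
and decreases with it (`integral_couplingLogDensity`). The variational bound
`ofReal_integral_le_klDiv` applied to `F` bounds the mutual information of every admissible channel
from below, and the Gaussian coupling attains the bound because it is the tilting of `μ.prod μ` by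
`F`.

The finite-dimensional program is the same argument in the variables `ρ i = √(1 - γ i / l i)`: a
strictly convex rate under a linear constraint, compared with its tangent plane at `r`
(`programOptimal_zero`). -/

/-- The correlation coefficient between a source component of variance `l` and its reconstruction
of the same variance at water level `waterLevel ν l`. -/
noncomputable def waterCorr (ν l : ℝ) : ℝ :=
  √(1 - waterLevel ν l / l)

/-! ### Algebra of the water level and its correlation coefficient -/

section WaterLevel

variable {ν l : ℝ}

lemma one_lt_sqrt_waterLevel (hν : 0 < ν) (hl : 0 < l) : 1 < √(1 + 16 * ν ^ 2 * l ^ 2) := by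
  rw [Real.lt_sqrt zero_le_one]
  have : 0 < 16 * ν ^ 2 * l ^ 2 := by positivity
  linarith

lemma waterLevel_pos (hl : 0 < l) : 0 < waterLevel ν l := by
  unfold waterLevel; positivity

lemma waterLevel_lt (hν : 0 < ν) (hl : 0 < l) : waterLevel ν l < l := by
  have := one_lt_sqrt_waterLevel hν hl
  rw [waterLevel, div_lt_iff₀ (by positivity)]
  nlinarith

lemma waterCorr_sq (hν : 0 < ν) (hl : 0 < l) : waterCorr ν l ^ 2 = 1 - waterLevel ν l / l := by
  refine Real.sq_sqrt ?_
  rw [sub_nonneg, div_le_one hl]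
  exact (waterLevel_lt hν hl).le

lemma waterCorr_nonneg : 0 ≤ waterCorr ν l := Real.sqrt_nonneg _

lemma waterCorr_pos (hν : 0 < ν) (hl : 0 < l) : 0 < waterCorr ν l := by
  refine Real.sqrt_pos.2 ?_
  rw [sub_pos, div_lt_one hl]
  exact waterLevel_lt hν hl

lemma waterCorr_lt_one (hν : 0 < ν) (hl : 0 < l) : waterCorr ν l < 1 := by
  have h := waterCorr_sq hν hl
  have h1 : 0 < waterLevel ν l / l := div_pos (waterLevel_pos hl) hl
  nlinarith [waterCorr_nonneg (ν := ν) (l := l)]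

lemma one_sub_waterCorr_sq (hν : 0 < ν) (hl : 0 < l) :
    1 - waterCorr ν l ^ 2 = 2 / (1 + √(1 + 16 * ν ^ 2 * l ^ 2)) := by
  rw [waterCorr_sq hν hl, waterLevel]
  field_simp
  ring

lemma one_sub_waterCorr_sq_pos (hν : 0 < ν) (hl : 0 < l) : 0 < 1 - waterCorr ν l ^ 2 := by
  rw [one_sub_waterCorr_sq hν hl]; positivity

/-- With `s = √(1 + 16 ν² l²)`, one has `r² = (s - 1)/(s + 1)` and `1 - r² = 2/(s + 1)`. The squares
of both sides agree because `s² - 1 = 16 ν² l²`. -/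
lemma waterCorr_eq (hν : 0 < ν) (hl : 0 < l) :
    waterCorr ν l = 2 * ν * l * (1 - waterCorr ν l ^ 2) := by
  refine (sq_eq_sq₀ waterCorr_nonneg ?_).1 ?_
  · have := one_sub_waterCorr_sq_pos hν hl
    positivity
  have h := one_sub_waterCorr_sq hν hl
  have hs : √(1 + 16 * ν ^ 2 * l ^ 2) ^ 2 = 1 + 16 * ν ^ 2 * l ^ 2 := Real.sq_sqrt (by positivity)
  have h1 : waterCorr ν l ^ 2 = 1 - 2 / (1 + √(1 + 16 * ν ^ 2 * l ^ 2)) := by linarith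
  rw [mul_pow, h, h1]
  have : 0 < 1 + √(1 + 16 * ν ^ 2 * l ^ 2) := by positivity
  field_simp
  nlinarith

lemma sqrt_mul_sub_eq {γ : ℝ} (hl : 0 < l) : √(l * (l - γ)) = l * √(1 - γ / l) := by
  rw [show l * (l - γ) = l ^ 2 * (1 - γ / l) by field_simp, Real.sqrt_mul (by positivity),
    Real.sqrt_sq hl.le]

lemma sqrt_mul_sub_waterLevel (hl : 0 < l) : √(l * (l - waterLevel ν l)) = l * waterCorr ν l :=
  sqrt_mul_sub_eq hl

lemma log_rate_eq (hν : 0 < ν) (hl : 0 < l) :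
    Real.log ((1 + √(1 + 16 * ν ^ 2 * l ^ 2)) / 2) = -Real.log (1 - waterCorr ν l ^ 2) := by
  rw [one_sub_waterCorr_sq hν hl, ← Real.log_inv, inv_div]

/-- Tangent line bound for the strictly convex function `r ↦ -½ log (1 - r²)`. -/
lemma log_one_sub_sq_tangent {r ρ : ℝ} (hr : 0 < r) (hr1 : r < 1) (hρ : 0 ≤ ρ) (hρ1 : ρ < 1) :
    Real.log (1 - ρ ^ 2) ≤ Real.log (1 - r ^ 2) - 2 * (r / (1 - r ^ 2)) * (ρ - r) ∧
    (ρ ≠ r → Real.log (1 - ρ ^ 2) < Real.log (1 - r ^ 2) - 2 * (r / (1 - r ^ 2)) * (ρ - r)) := by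
  have a : 0 < 1 - r ^ 2 := by nlinarith
  have b : 0 < 1 - ρ ^ 2 := by nlinarith
  have key : (1 - ρ ^ 2) / (1 - r ^ 2) - 1
      = - 2 * (r / (1 - r ^ 2)) * (ρ - r) - (ρ - r) ^ 2 / (1 - r ^ 2) := by
    field_simp; ring
  have hlog := Real.log_le_sub_one_of_pos (div_pos b a)
  rw [Real.log_div b.ne' a.ne', key] at hlog
  refine ⟨?_, fun hne => ?_⟩
  · have : 0 ≤ (ρ - r) ^ 2 / (1 - r ^ 2) := by positivity
    linarith
  · have : 0 < (ρ - r) ^ 2 / (1 - r ^ 2) := by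
      have := sub_ne_zero.2 hne
      positivity
    linarith

end WaterLevel

/-- Intermediate value theorem in `ν`: the distortion is continuous, equals `2 ∑ l i` at `ν = 0`,
and is small for large `ν`. -/
lemma exists_distortion_eq {L : ℕ} {l : Fin L → ℝ} (hl : ∀ i, 0 < l i) {D : ℝ} (hD0 : 0 < D)
    (hD : D < 2 * ∑ i, l i) :
    ∃ ν : ℝ, 0 < ν ∧ D = ∑ i, (2 * l i - 2 * √(l i * (l i - waterLevel ν (l i)))) := by
  set f : ℝ → ℝ := fun ν => ∑ i, (2 * l i - 2 * √(l i * (l i - waterLevel ν (l i)))) with hf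
  have hcont : Continuous f := by
    unfold f waterLevel
    refine continuous_finsetSum _ fun i _ => ?_
    have : ∀ ν : ℝ, 1 + √(1 + 16 * ν ^ 2 * l i ^ 2) ≠ 0 := fun ν => by positivity
    fun_prop (disch := exact this)
  have h0 : f 0 = 2 * ∑ i, l i := by
    simp only [hf, Finset.mul_sum]
    refine Finset.sum_congr rfl fun i _ => ?_
    have : waterLevel 0 (l i) = l i := by simp [waterLevel]; ring
    simp [this]
  obtain ⟨N, hN0, hN⟩ : ∃ N : ℝ, 0 < N ∧ f N ≤ D := by
    -- By `waterCorr_eq`, each term `2 l (1 - r)` equals `r / (N (1 + r))`, hence is at most `1 /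
    -- N`. The `L` terms then add up to at most `L / N ≤ D`; the `+ 1` keeps `N` positive without a
    -- case split on `L`.
    refine ⟨(L + 1) / D, by positivity, ?_⟩
    set N := (L + 1) / D with hNdef
    have hN0 : 0 < N := by positivity
    have hterm : ∀ i, 2 * l i - 2 * √(l i * (l i - waterLevel N (l i))) ≤ 1 / N := fun i => by
      rw [sqrt_mul_sub_waterLevel (hl i)]
      have h1 := waterCorr_eq hN0 (hl i)
      have h2 := waterCorr_lt_one hN0 (hl i)
      have h3 := waterCorr_pos hN0 (hl i)
      have hli := hl i
      rw [le_div_iff₀ hN0]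
      have : 0 < N * l i := by positivity
      nlinarith [mul_pos this h3, mul_pos this (sub_pos.2 h2), mul_pos (mul_pos this (sub_pos.2 h2)) h3]
    calc f N ≤ ∑ _i : Fin L, 1 / N := Finset.sum_le_sum fun i _ => hterm i
      _ = L / (L + 1) * D := by simp [hNdef]; field_simp
      _ ≤ D := by
        refine mul_le_of_le_one_left hD0.le ?_
        rw [div_le_one (by positivity)]; linarith
  obtain ⟨ν, hν, hfν⟩ := intermediate_value_Icc' hN0.le hcont.continuousOn
    (⟨hN, by rw [h0]; exact hD.le⟩ : D ∈ Set.Icc (f N) (f 0))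
  refine ⟨ν, lt_of_le_of_ne hν.1 ?_, hfν.symm⟩
  rintro rfl
  rw [h0] at hfν
  exact hD.ne hfν.symm

/-! ### The water-filling program at zero perception loss -/

section Program

lemma componentKL_eq_zero_iff {l l' : ℝ} (hl : 0 < l) (hl' : 0 ≤ l') :
    componentKL l l' = 0 ↔ l' = l := by
  unfold componentKL
  constructor
  · intro h
    split_ifs at h with h0
    · simp at h
    have hpos : 0 < l' := lt_of_le_of_ne hl' (Ne.symm h0)
    rw [ENNReal.ofReal_eq_zero] at h
    by_contra hne
    have h1 : l' / l ≠ 1 := fun h => hne ((div_eq_one_iff_eq hl.ne').1 h)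
    have h2 := Real.log_lt_sub_one_of_pos (div_pos hpos hl) h1
    have h3 : Real.log (l / l') = -Real.log (l' / l) := by rw [← Real.log_inv, inv_div]
    linarith
  · rintro rfl
    simp [hl.ne']

lemma componentW2_eq_zero_iff {l l' : ℝ} (hl : 0 < l) (hl' : 0 ≤ l') :
    componentW2 l l' = 0 ↔ l' = l := by
  unfold componentW2
  rw [ENNReal.ofReal_eq_zero, sq_nonpos_iff, sub_eq_zero, Real.sqrt_inj hl.le hl', eq_comm]

lemma programOptimal_zero {L : ℕ} {p : ℝ → ℝ → ℝ≥0∞} {l : Fin L → ℝ} (hl : ∀ i, 0 < l i)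
    (hp : ∀ i l', 0 ≤ l' → (p (l i) l' = 0 ↔ l' = l i)) {D ν : ℝ} (hν : 0 < ν)
    (hD : D = ∑ i, (2 * l i - 2 * √(l i * (l i - waterLevel ν (l i))))) :
    programOptimal p l D 0 = {(fun i => waterLevel ν (l i), l)} := by
  have hD' : D = ∑ i, (2 * l i - 2 * (l i * waterCorr ν (l i))) := by
    simp_rw [hD, sqrt_mul_sub_waterLevel (hl _)]
  have hfeas : (fun i => waterLevel ν (l i), l) ∈ programFeasible p l D 0 := by
    refine ⟨fun i => ⟨waterLevel_pos (hl i), (waterLevel_lt hν (hl i)).le⟩, fun i => (hl i).le,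
      ?_, ?_⟩
    · rw [hD]
      refine Finset.sum_le_sum fun i _ => ?_
      simp only [componentDistortion]
      linarith
    · simp [(hp _ _ (hl _).le).2 rfl]
  have hrate : ∀ y ∈ programFeasible p l D 0, y.2 = l ∧
      (∑ i, Real.log (l i / waterLevel ν (l i)) ≤ ∑ i, Real.log (l i / y.1 i)) ∧
      (y.1 ≠ (fun i => waterLevel ν (l i)) →
        ∑ i, Real.log (l i / waterLevel ν (l i)) < ∑ i, Real.log (l i / y.1 i)) := by
    rintro ⟨g, l'⟩ ⟨hg, hl', hdist, hperc⟩
    have hll : l' = l := by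
      funext i
      rw [nonpos_iff_eq_zero, Finset.sum_eq_zero_iff] at hperc
      exact (hp i _ (hl' i)).1 (hperc i (Finset.mem_univ i))
    subst hll
    set ρ : Fin L → ℝ := fun i => √(1 - g i / l' i) with hρ
    set r : Fin L → ℝ := fun i => waterCorr ν (l' i) with hr
    have hgl : ∀ i, g i / l' i ≤ 1 := fun i => (div_le_one (hl i)).2 (hg i).2
    have hgl0 : ∀ i, 0 < g i / l' i := fun i => div_pos (hg i).1 (hl i)
    have hρsq : ∀ i, 1 - ρ i ^ 2 = g i / l' i := fun i => by
      simp only [hρ, Real.sq_sqrt (sub_nonneg.2 (hgl i))]; ring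
    have hρ0 : ∀ i, 0 ≤ ρ i := fun i => Real.sqrt_nonneg _
    have hρ1 : ∀ i, ρ i < 1 := fun i => by nlinarith [hρsq i, hgl0 i, hρ0 i]
    -- The candidate `r` spends the distortion budget exactly, so any feasible `ρ` has at least the
    -- same weighted correlation.
    have hcorr : 0 ≤ ∑ i, l' i * (ρ i - r i) := by
      have h1 : ∑ i, componentDistortion (l' i) (g i) (l' i)
          = ∑ i, (2 * l' i - 2 * (l' i * ρ i)) := by
        refine Finset.sum_congr rfl fun i _ => ?_
        rw [componentDistortion, sqrt_mul_sub_eq (hl i)]; ring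
      have h2 : ∑ i, (2 * l' i - 2 * (l' i * ρ i)) - ∑ i, (2 * l' i - 2 * (l' i * r i))
          = -2 * ∑ i, l' i * (ρ i - r i) := by
        rw [← Finset.sum_sub_distrib, Finset.mul_sum]
        exact Finset.sum_congr rfl fun i _ => by ring
      simp only at hdist
      linarith
    have hlog : ∀ i, Real.log (l' i / g i) = -Real.log (1 - ρ i ^ 2) := fun i => by
      rw [hρsq, ← Real.log_inv, inv_div]
    have hlogw : ∀ i, Real.log (l' i / waterLevel ν (l' i)) = -Real.log (1 - r i ^ 2) := fun i => by
      rw [show 1 - r i ^ 2 = waterLevel ν (l' i) / l' i by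
        simp only [hr, waterCorr_sq hν (hl i)]; ring, ← Real.log_inv, inv_div]
    have hslope : ∀ i, r i / (1 - r i ^ 2) = 2 * ν * l' i := fun i => by
      rw [div_eq_iff (one_sub_waterCorr_sq_pos hν (hl i)).ne']
      exact waterCorr_eq hν (hl i)
    have htan := fun i => log_one_sub_sq_tangent (waterCorr_pos hν (hl i))
      (waterCorr_lt_one hν (hl i)) (hρ0 i) (hρ1 i)
    -- Tangent slopes are proportional to the constraint weights `l' i`, so the first-order terms
    -- sum to a multiple of the quantity in `hcorr`.
    have hsum : ∑ i, Real.log (l' i / waterLevel ν (l' i))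
        ≤ ∑ i, (-Real.log (1 - r i ^ 2) + 4 * ν * (l' i * (ρ i - r i))) := by
      rw [Finset.sum_add_distrib, ← Finset.mul_sum]
      simp_rw [hlogw]
      have := mul_nonneg (mul_nonneg zero_le_four hν.le) hcorr
      linarith
    refine ⟨rfl, hsum.trans (Finset.sum_le_sum fun i _ => ?_), fun hne => hsum.trans_lt ?_⟩
    · have := (htan i).1
      have h3 := hslope i
      simp only [hr] at h3 ⊢
      rw [h3] at this
      simp only [hlog]
      linarith
    · obtain ⟨j, hj⟩ := Function.ne_iff.1 hne
      refine Finset.sum_lt_sum (fun i _ => ?_) ⟨j, Finset.mem_univ j, ?_⟩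
      · have := (htan i).1
        have h3 := hslope i
        simp only [hr] at h3 ⊢
        rw [h3] at this
        simp only [hlog]
        linarith
      · have hjne : ρ j ≠ waterCorr ν (l' j) := fun h => hj <| by
          have h4 := hρsq j
          rw [h, waterCorr_sq hν (hl j)] at h4
          have h5 : waterLevel ν (l' j) / l' j = g j / l' j := by linarith
          exact ((div_left_inj' (hl j).ne').1 h5).symm
        have := (htan j).2 hjne
        have h3 := hslope j
        simp only [hr] at h3 ⊢
        rw [h3] at this
        simp only [hlog]
        linarith
  ext y
  rw [Set.mem_singleton_iff]
  constructor
  · rintro ⟨hy, hmin⟩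
    obtain ⟨h2, -, hlt⟩ := hrate y hy
    refine Prod.ext ?_ h2
    by_contra hne
    have h1 := hmin hfeas
    have h3 := hlt hne
    simp only [Set.mem_ofPred_eq] at h1
    linarith
  · rintro rfl
    refine ⟨hfeas, fun y hy => ?_⟩
    have := (hrate y hy).2.1
    simp only [Set.mem_ofPred_eq]
    linarith

end Program

/-! ### Variational bound for the Kullback-Leibler divergence and its equality case -/

section KullbackLeibler

variable {α : Type*} {mα : MeasurableSpace α}

/-- The variational lower bound on the Kullback-Leibler divergence. -/
lemma ofReal_integral_le_klDiv {π q : Measure α} [IsProbabilityMeasure π] [IsProbabilityMeasure q]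
    {f : α → ℝ} (hf : Integrable f π) (hexp : Integrable (fun x => Real.exp (f x)) q)
    (hone : ∫ x, Real.exp (f x) ∂q = 1) : ENNReal.ofReal (∫ x, f x ∂π) ≤ klDiv π q := by
  by_cases h : klDiv π q = ∞
  · simp [h]
  obtain ⟨hac, hint⟩ := klDiv_ne_top_iff.1 h
  have hprob : IsProbabilityMeasure (q.tilted f) := isProbabilityMeasure_tilted hexp
  have hac' : π ≪ q.tilted f := hac.trans (absolutelyContinuous_tilted hexp)
  have h1 := integral_llr_tilted_right hac hf hexp hint
  -- Nonnegativity of the divergence of `π` from `q.tilted f`; by `h1` this is the divergence from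
  -- `q` minus `∫ f ∂π`.
  have h2 := integral_llr_add_sub_measure_univ_nonneg hac' (integrable_llr_tilted_right hac hf hint hexp)
  rw [klDiv_of_ac_of_integrable hac hint]
  refine ENNReal.ofReal_le_ofReal ?_
  simp only [hone, Real.log_one, probReal_univ] at *
  linarith

lemma klDiv_tilted_left {q : Measure α} [IsProbabilityMeasure q]
    {f : α → ℝ} (hf : Integrable f (q.tilted f)) (hexp : Integrable (fun x => Real.exp (f x)) q)
    (hone : ∫ x, Real.exp (f x) ∂q = 1) :
    klDiv (q.tilted f) q = ENNReal.ofReal (∫ x, f x ∂(q.tilted f)) := by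
  have hprob : IsProbabilityMeasure (q.tilted f) := isProbabilityMeasure_tilted hexp
  have hac := tilted_absolutelyContinuous q f
  have hllr : llr (q.tilted f) q =ᵐ[q.tilted f] f := by
    filter_upwards [hac.ae_le (log_rnDeriv_tilted_left_self hexp)] with x hx
    rw [llr, hx, hone, Real.log_one, sub_zero]
  rw [klDiv_of_ac_of_integrable hac ((integrable_congr hllr).2 hf), integral_congr_ae hllr]
  simp

end KullbackLeibler

/-! ### Vanishing of the perception losses -/

section Wasserstein

variable {L : ℕ}

lemma norm_exp_mul_I_sub_le (a b : ℝ) :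
    ‖Complex.exp (a * Complex.I) - Complex.exp (b * Complex.I)‖ ≤ |a - b| := by
  have h : Complex.exp (a * Complex.I) - Complex.exp (b * Complex.I)
      = Complex.exp (b * Complex.I) * (Complex.exp (Complex.I * ((a - b : ℝ) : ℂ)) - 1) := by
    rw [mul_sub, ← Complex.exp_add, mul_one]
    congr 2
    push_cast; ring
  rw [h, norm_mul, Complex.norm_exp_ofReal_mul_I, one_mul]
  exact Real.norm_exp_I_mul_ofReal_sub_one_le

lemma meanSquaredError_ne_top_integrable {π : Measure (Vec L × Vec L)}
    (h : meanSquaredError π ≠ ∞) : Integrable (fun p : Vec L × Vec L => ‖p.1 - p.2‖ ^ 2) π := by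
  refine (lintegral_ofReal_ne_top_iff_integrable (by fun_prop) ?_).1 h
  exact Filter.Eventually.of_forall fun p => by positivity

lemma integral_le_of_meanSquaredError_le {π : Measure (Vec L × Vec L)} {d : ℝ} (hd : 0 ≤ d)
    (h : meanSquaredError π ≤ ENNReal.ofReal d) : ∫ p, ‖p.1 - p.2‖ ^ 2 ∂π ≤ d := by
  have hint := meanSquaredError_ne_top_integrable (h.trans_lt ENNReal.ofReal_lt_top).ne
  rw [meanSquaredError, ← ofReal_integral_eq_lintegral_ofReal hint
    (Filter.Eventually.of_forall fun p => by positivity)] at h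
  exact (ENNReal.ofReal_le_ofReal_iff hd).1 h

/-- The map `a ↦ exp (i a)` is 1-Lipschitz, so Cauchy-Schwarz bounds the difference by `‖t‖` times
the mean of `‖p.1 - p.2‖`. The latter is controlled through `s ≤ ε + s² / ε`. -/
lemma norm_charFun_sub_le {π : Measure (Vec L × Vec L)} [IsProbabilityMeasure π] {ε : ℝ}
    (hε : 0 < ε) (h : meanSquaredError π ≤ ENNReal.ofReal (ε ^ 2)) (t : Vec L) :
    ‖charFun π.fst t - charFun π.snd t‖ ≤ ‖t‖ * (2 * ε) := by
  have hint := meanSquaredError_ne_top_integrable (h.trans_lt ENNReal.ofReal_lt_top).ne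
  have hle := integral_le_of_meanSquaredError_le (by positivity) h
  have hb : ∀ (g : Vec L × Vec L → Vec L), Measurable g →
      Integrable (fun p => Complex.exp ((inner ℝ (g p) t : ℝ) * Complex.I)) π := fun g hg => by
    refine Integrable.of_bound (C := 1) (by fun_prop) (Filter.Eventually.of_forall fun p => ?_)
    rw [Complex.norm_exp_ofReal_mul_I]
  rw [charFun_apply, charFun_apply, Measure.fst, Measure.snd,
    integral_map (by fun_prop) (by fun_prop), integral_map (by fun_prop) (by fun_prop),
    ← integral_sub (hb _ measurable_fst) (hb _ measurable_snd)]
  have hbound : Integrable (fun p : Vec L × Vec L => ‖t‖ * (ε + ‖p.1 - p.2‖ ^ 2 / ε)) π :=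
    ((integrable_const _).add (hint.div_const _)).const_mul _
  refine (norm_integral_le_of_norm_le hbound (Filter.Eventually.of_forall fun p => ?_)).trans ?_
  · refine (norm_exp_mul_I_sub_le _ _).trans ?_
    rw [← inner_sub_left, mul_comm]
    refine (abs_real_inner_le_norm _ _).trans
      (mul_le_mul_of_nonneg_right ?_ (norm_nonneg _))
    rw [← sub_le_iff_le_add', le_div_iff₀ hε]
    nlinarith [sq_nonneg (‖p.1 - p.2‖ - ε), norm_nonneg (p.1 - p.2)]
  · rw [integral_const_mul, integral_add (integrable_const _) (hint.div_const _), integral_div]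
    refine mul_le_mul_of_nonneg_left ?_ (norm_nonneg _)
    have : (∫ p, ‖p.1 - p.2‖ ^ 2 ∂π) / ε ≤ ε := by
      rw [div_le_iff₀ hε]; nlinarith
    simp
    linarith

/-- No optimal coupling is needed: couplings of arbitrarily small cost already force the
characteristic functions to agree. Conversely the diagonal coupling has zero cost. -/
lemma wassersteinPerception_eq_zero_iff {μ ν : Measure (Vec L)} [IsProbabilityMeasure μ]
    [IsProbabilityMeasure ν] : wassersteinPerception μ ν = 0 ↔ ν = μ := by
  constructor
  · intro h
    refine (Measure.ext_of_charFun (funext fun t => ?_)).symm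
    rw [← sub_eq_zero, ← norm_le_zero_iff]
    refine le_of_forall_gt_imp_ge_of_dense fun δ hδ => ?_
    set ε := δ / (2 * (‖t‖ + 1)) with hεdef
    have hε : 0 < ε := by positivity
    have hlt : wassersteinPerception μ ν < ENNReal.ofReal (ε ^ 2) := by
      rw [h, ENNReal.ofReal_pos]; positivity
    simp only [wassersteinPerception, iInf_lt_iff] at hlt
    obtain ⟨π, h1, h2, h3⟩ := hlt
    have hprob : IsProbabilityMeasure π := by
      constructor
      rw [← Measure.fst_univ, h1, measure_univ]
    have := norm_charFun_sub_le hε h3.le t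
    rw [h1, h2] at this
    refine this.trans ?_
    rw [hεdef]
    field_simp
    linarith
  · rintro rfl
    rw [← nonpos_iff_eq_zero]
    refine (iInf₂_le (ν.map fun x => (x, x)) ?_).trans ((iInf_le _ ?_).trans ?_)
    · rw [Measure.fst, Measure.map_map (by fun_prop) (by fun_prop)]
      exact Measure.map_id
    · rw [Measure.snd, Measure.map_map (by fun_prop) (by fun_prop)]
      exact Measure.map_id
    · rw [meanSquaredError, lintegral_map (by fun_prop) (by fun_prop)]
      simp

lemma klPerception_eq_zero_iff {μ ν : Measure (Vec L)} [IsProbabilityMeasure μ]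
    [IsProbabilityMeasure ν] : klPerception μ ν = 0 ↔ ν = μ :=
  klDiv_eq_zero_iff

end Wasserstein

/-! ### Product densities on product measures -/

section PiWithDensity

lemma pi_withDensity_prod {ι : Type*} [Fintype ι] {E : ι → Type*} [∀ i, MeasurableSpace (E i)]
    {μ : ∀ i, Measure (E i)} [∀ i, IsProbabilityMeasure (μ i)] {g : ∀ i, E i → ℝ}
    (hg0 : ∀ i x, 0 ≤ g i x) (hg : ∀ i, Integrable (g i) (μ i)) :
    (Measure.pi μ).withDensity (fun x => ENNReal.ofReal (∏ i, g i (x i)))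
      = Measure.pi fun i => (μ i).withDensity fun x => ENNReal.ofReal (g i x) := by
  have hfin : ∀ i, IsFiniteMeasure ((μ i).withDensity fun x => ENNReal.ofReal (g i x)) := fun i =>
    isFiniteMeasure_withDensity_ofReal (hg i).2
  refine (Measure.pi_eq fun s hs => ?_).symm
  rw [withDensity_apply _ (MeasurableSet.univ_pi hs), Measure.restrict_pi_pi,
    ← ofReal_integral_eq_lintegral_ofReal
      (Integrable.fintype_prod_dep fun i => (hg i).restrict)
      (Filter.Eventually.of_forall fun x => Finset.prod_nonneg fun i _ => hg0 i _),
    integral_fintype_prod_eq_prod (𝕜 := ℝ),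
    ENNReal.ofReal_prod_of_nonneg fun i _ => integral_nonneg (hg0 i)]
  refine Finset.prod_congr rfl fun i _ => ?_
  rw [withDensity_apply _ (hs i), ofReal_integral_eq_lintegral_ofReal (hg i).restrict
    (Filter.Eventually.of_forall (hg0 i))]

end PiWithDensity

/-- Logarithm of the density of the centered Gaussian law on `ℝ²` with variances `l` and
correlation coefficient `r`, with respect to the product of its marginals. -/
noncomputable def gaussianLogCopula (l r x y : ℝ) : ℝ :=
  -(Real.log (1 - r ^ 2) / 2) - (r ^ 2 * (x ^ 2 + y ^ 2) - 2 * r * (x * y)) / (2 * l * (1 - r ^ 2))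

lemma gaussianLogCopula_comm (l r x y : ℝ) :
    gaussianLogCopula l r x y = gaussianLogCopula l r y x := by
  unfold gaussianLogCopula; ring_nf

/-! ### The bivariate Gaussian coupling of one component -/

section OneDim

variable {l r : ℝ}

/-- Completing the square: given `x`, the second variable of the coupling is Gaussian with mean `r
x` and variance `l (1 - r²)`. -/
lemma gaussianPDFReal_mul_exp_gaussianLogCopula (hl : 0 < l) (hr : 0 < 1 - r ^ 2) (x y : ℝ) :
    gaussianPDFReal 0 l.toNNReal y * Real.exp (gaussianLogCopula l r x y)
      = gaussianPDFReal (r * x) (l * (1 - r ^ 2)).toNNReal y := by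
  have h1 : Real.exp (-(Real.log (1 - r ^ 2) / 2)) = (√(1 - r ^ 2))⁻¹ := by
    rw [Real.exp_neg, Real.exp_half, Real.exp_log hr]
  simp only [gaussianPDFReal, gaussianLogCopula, Real.coe_toNNReal l hl.le,
    Real.coe_toNNReal _ (mul_pos hl hr).le]
  rw [sub_eq_add_neg (-(Real.log (1 - r ^ 2) / 2)), Real.exp_add, h1,
    show 2 * Real.pi * (l * (1 - r ^ 2)) = (2 * Real.pi * l) * (1 - r ^ 2) by ring,
    Real.sqrt_mul (by positivity : 0 ≤ 2 * Real.pi * l), mul_inv]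
  have h2 : Real.exp (-(y - r * x) ^ 2 / (2 * (l * (1 - r ^ 2))))
      = Real.exp (-(y - 0) ^ 2 / (2 * l)) *
        Real.exp (-((r ^ 2 * (x ^ 2 + y ^ 2) - 2 * r * (x * y)) / (2 * l * (1 - r ^ 2)))) := by
    rw [← Real.exp_add]
    congr 1
    field_simp
    ring
  rw [h2]
  ring

lemma measurable_gaussianLogCopula_right (l r x : ℝ) : Measurable (gaussianLogCopula l r x) := by
  unfold gaussianLogCopula; fun_prop

lemma gaussianReal_withDensity_gaussianLogCopula (hl : 0 < l) (hr : 0 < 1 - r ^ 2) (x : ℝ) :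
    (gaussianReal 0 l.toNNReal).withDensity
        (fun y => ENNReal.ofReal (Real.exp (gaussianLogCopula l r x y)))
      = gaussianReal (r * x) (l * (1 - r ^ 2)).toNNReal := by
  have h1 : l.toNNReal ≠ 0 := (Real.toNNReal_pos.2 hl).ne'
  have h2 : (l * (1 - r ^ 2)).toNNReal ≠ 0 := (Real.toNNReal_pos.2 (mul_pos hl hr)).ne'
  rw [gaussianReal_of_var_ne_zero _ h1, gaussianReal_of_var_ne_zero _ h2,
    ← withDensity_mul _ (measurable_gaussianPDF _ _)
      (measurable_gaussianLogCopula_right l r x).exp.ennreal_ofReal]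
  congr 1
  funext y
  simp only [Pi.mul_apply, gaussianPDF]
  rw [← ENNReal.ofReal_mul (gaussianPDFReal_nonneg _ _ _),
    gaussianPDFReal_mul_exp_gaussianLogCopula hl hr]

lemma integrable_exp_gaussianLogCopula (hl : 0 < l) (hr : 0 < 1 - r ^ 2) (x : ℝ) :
    Integrable (fun y => Real.exp (gaussianLogCopula l r x y)) (gaussianReal 0 l.toNNReal) := by
  refine (lintegral_ofReal_ne_top_iff_integrable
    (measurable_gaussianLogCopula_right l r x).exp.aestronglyMeasurable
    (Filter.Eventually.of_forall fun y => (Real.exp_pos _).le)).1 ?_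
  rw [← setLIntegral_univ, ← withDensity_apply _ MeasurableSet.univ,
    gaussianReal_withDensity_gaussianLogCopula hl hr]
  simp

lemma integrable_sq_gaussianReal (m : ℝ) (v : NNReal) :
    Integrable (fun y => y ^ 2) (gaussianReal m v) :=
  (memLp_id_gaussianReal (μ := m) (v := v) 2).integrable_sq

lemma integral_sub_sq_gaussianReal (m a : ℝ) (v : NNReal) :
    ∫ y, (a - y) ^ 2 ∂(gaussianReal m v) = v + (a - m) ^ 2 := by
  have hint : Integrable (fun y => y) (gaussianReal m v) :=
    (memLp_id_gaussianReal (μ := m) (v := v) 1).integrable le_rfl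
  have h2 : ∫ y, y ^ 2 ∂(gaussianReal m v) = v + m ^ 2 := by
    have h := variance_eq_sub (memLp_id_gaussianReal (μ := m) (v := v) 2)
    rw [variance_id_gaussianReal] at h
    simp only [Pi.pow_apply, id_eq, integral_id_gaussianReal] at h
    linarith
  have h3 : (fun y : ℝ => (a - y) ^ 2) = fun y => a ^ 2 - 2 * a * y + y ^ 2 := by
    funext y; ring
  have h4 : Integrable (fun y : ℝ => a ^ 2 - 2 * a * y) (gaussianReal m v) :=
    (integrable_const _).sub (hint.const_mul _)
  rw [h3, integral_add h4 (integrable_sq_gaussianReal m v),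
    integral_sub (integrable_const _) (hint.const_mul _), integral_const_mul,
    integral_id_gaussianReal, h2]
  simp
  ring

lemma integral_sq_gaussianReal_zero {l : ℝ} (hl : 0 < l) :
    ∫ y, y ^ 2 ∂(gaussianReal 0 l.toNNReal) = l := by
  have h := integral_sub_sq_gaussianReal 0 0 l.toNNReal
  simpa [hl.le] using h

lemma lintegral_sub_sq_gaussianReal (m a : ℝ) (v : NNReal) :
    ∫⁻ y, ENNReal.ofReal ((a - y) ^ 2) ∂(gaussianReal m v) = ENNReal.ofReal (v + (a - m) ^ 2) := by
  rw [← integral_sub_sq_gaussianReal m a v, ofReal_integral_eq_lintegral_ofReal]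
  · exact ((memLp_const a).sub (memLp_id_gaussianReal (μ := m) (v := v) 2)).integrable_sq
  · exact Filter.Eventually.of_forall fun y => sq_nonneg _

end OneDim

/-! ### Decorrelating orthogonal coordinates -/

section Coordinates

variable {L : ℕ} {S Θ : Matrix (Fin L) (Fin L) ℝ} {l : Fin L → ℝ}

open Matrix in
lemma posDef_conj_diagonal_pos (hS : S.PosDef) (hΘ : Θ ∈ Matrix.orthogonalGroup (Fin L) ℝ)
    (hdec : S = Θ.transpose * Matrix.diagonal l * Θ) (i : Fin L) : 0 < l i := by
  have hunit : IsUnit Θ :=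
    ⟨⟨Θ, star Θ, (Matrix.mem_unitaryGroup_iff).1 hΘ, (Matrix.mem_unitaryGroup_iff').1 hΘ⟩, rfl⟩
  have h : (star Θ * Matrix.diagonal l * Θ).PosDef := by
    rw [Matrix.star_eq_conjTranspose, Matrix.conjTranspose_eq_transpose_of_trivial, ← hdec]
    exact hS
  rw [hunit.posDef_star_left_conjugate_iff, Matrix.posDef_diagonal_iff] at h
  exact h i

open Matrix in
-- The characteristic functions agree, since `Θ S Θᵀ` is the diagonal matrix of the `l i`.
lemma measurePreserving_mulVec_multivariateGaussian (hS : S.PosDef)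
    (hΘ : Θ ∈ Matrix.orthogonalGroup (Fin L) ℝ)
    (hdec : S = Θ.transpose * Matrix.diagonal l * Θ) :
    MeasurePreserving (fun x : Vec L => Θ *ᵥ x.ofLp) (multivariateGaussian 0 S)
      (Measure.pi fun i => gaussianReal 0 (l i).toNNReal) := by
  have hl := posDef_conj_diagonal_pos hS hΘ hdec
  have hΘΘ : Θ * Θᵀ = 1 := (Matrix.mem_unitaryGroup_iff).1 hΘ
  have hmeas : Measurable fun x : Vec L => Θ *ᵥ x.ofLp :=
    (Continuous.matrix_mulVec continuous_const (by fun_prop)).measurable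
  -- Both laws are carried to the Euclidean space, where the inner product needed for `charFun`
  -- lives.
  have hkey : (multivariateGaussian 0 S).map (fun x : Vec L => WithLp.toLp 2 (Θ *ᵥ x.ofLp))
      = (Measure.pi fun i => gaussianReal 0 (l i).toNNReal).map (WithLp.toLp 2) := by
    have : IsProbabilityMeasure ((multivariateGaussian 0 S).map
        (fun x : Vec L => WithLp.toLp 2 (Θ *ᵥ x.ofLp))) :=
      Measure.isProbabilityMeasure_map (by fun_prop)
    have : IsProbabilityMeasure ((Measure.pi fun i => gaussianReal 0 (l i).toNNReal).map
        (WithLp.toLp 2 : (Fin L → ℝ) → Vec L)) :=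
      Measure.isProbabilityMeasure_map (by fun_prop)
    refine Measure.ext_of_charFun (funext fun t => ?_)
    rw [charFun_pi]
    have h1 : charFun ((multivariateGaussian 0 S).map
        (fun x : Vec L => WithLp.toLp 2 (Θ *ᵥ x.ofLp))) t
        = charFun (multivariateGaussian 0 S) (WithLp.toLp 2 (Θᵀ *ᵥ t.ofLp)) := by
      rw [charFun_apply, charFun_apply, integral_map (by fun_prop) (by fun_prop)]
      refine integral_congr_ae (Filter.Eventually.of_forall fun x => ?_)
      simp only [EuclideanSpace.inner_eq_star_dotProduct, star_trivial]
      rw [Matrix.dotProduct_mulVec, ← Matrix.mulVec_transpose]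
    rw [h1, charFun_multivariateGaussian hS.posSemidef]
    have h2 : (WithLp.toLp 2 (Θᵀ *ᵥ t.ofLp) : Vec L) ⬝ᵥ
        (S *ᵥ (WithLp.toLp 2 (Θᵀ *ᵥ t.ofLp) : Vec L)) = ∑ i, l i * t i ^ 2 := by
      change (Θᵀ *ᵥ t.ofLp) ⬝ᵥ (S *ᵥ (Θᵀ *ᵥ t.ofLp)) = _
      rw [hdec, Matrix.mulVec_mulVec, Matrix.mul_assoc, hΘΘ, Matrix.mul_one,
        Matrix.dotProduct_mulVec, ← Matrix.mulVec_transpose, Matrix.mulVec_mulVec,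
        Matrix.transpose_mul, Matrix.diagonal_transpose, Matrix.transpose_transpose,
        Matrix.mul_assoc, hΘΘ, Matrix.mul_one]
      simp only [dotProduct, Matrix.mulVec_diagonal]
      exact Finset.sum_congr rfl fun i _ => by ring
    rw [h2]
    simp_rw [charFun_gaussianReal, ← Complex.exp_sum]
    congr 1
    simp [Real.coe_toNNReal _ (hl _).le, Finset.sum_div]
  refine ⟨hmeas, ?_⟩
  have h3 := congrArg (Measure.map (WithLp.ofLp : Vec L → Fin L → ℝ)) hkey
  rw [Measure.map_map (by fun_prop) (by fun_prop), Measure.map_map (by fun_prop) (by fun_prop)]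
    at h3
  simpa [Function.comp_def] using h3

open Matrix in
lemma norm_sq_eq_sum_mulVec (hΘ : Θ ∈ Matrix.orthogonalGroup (Fin L) ℝ) (x : Vec L) :
    ‖x‖ ^ 2 = ∑ i, (Θ *ᵥ x.ofLp) i ^ 2 := by
  have hΘΘ : Θᵀ * Θ = 1 := (Matrix.mem_unitaryGroup_iff').1 hΘ
  have : ∑ i, (Θ *ᵥ x.ofLp) i ^ 2 = (Θ *ᵥ x.ofLp) ⬝ᵥ (Θ *ᵥ x.ofLp) := by
    simp [dotProduct, sq]
  rw [this, Matrix.dotProduct_mulVec, ← Matrix.mulVec_transpose, Matrix.mulVec_mulVec, hΘΘ,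
    Matrix.one_mulVec, EuclideanSpace.real_norm_sq_eq]
  simp [dotProduct, sq]

end Coordinates

/-! ### The optimal Gaussian channel -/

section Channel

variable {L : ℕ}

/-- Sum over the coordinates `c` of the logarithmic densities of the componentwise Gaussian
couplings with correlation coefficients `r`. -/
noncomputable def couplingLogDensity (c : Vec L → Fin L → ℝ) (l r : Fin L → ℝ)
    (p : Vec L × Vec L) : ℝ :=
  ∑ i, gaussianLogCopula (l i) (r i) (c p.1 i) (c p.2 i)

/-- The channel with density `exp (couplingLogDensity c l r)` with respect to the source law. -/
noncomputable def gaussianChannel (μ : Measure (Vec L)) [SFinite μ] (c : Vec L → Fin L → ℝ)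
    (l r : Fin L → ℝ) : Kernel (Vec L) (Vec L) :=
  (Kernel.const (Vec L) μ).withDensity fun x y =>
    ENNReal.ofReal (Real.exp (couplingLogDensity c l r (x, y)))

variable {μ : Measure (Vec L)} [IsProbabilityMeasure μ] {c : Vec L → Fin L → ℝ} {l r : Fin L → ℝ}

lemma couplingLogDensity_comm (x y : Vec L) :
    couplingLogDensity c l r (x, y) = couplingLogDensity c l r (y, x) :=
  Finset.sum_congr rfl fun _ _ => gaussianLogCopula_comm _ _ _ _

lemma measurable_couplingLogDensity (hc : Measurable c) :
    Measurable (couplingLogDensity c l r) := by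
  unfold couplingLogDensity gaussianLogCopula
  have h (i : Fin L) : Measurable fun x => c x i := (measurable_pi_apply i).comp hc
  have h1 (i : Fin L) : Measurable fun p : Vec L × Vec L => c p.1 i := (h i).comp measurable_fst
  have h2 (i : Fin L) : Measurable fun p : Vec L × Vec L => c p.2 i := (h i).comp measurable_snd
  refine Finset.measurable_fun_sum _ fun i _ => ?_
  have h1 := h1 i
  have h2 := h2 i
  fun_prop

lemma gaussianChannel_apply (hc : Measurable c) (x : Vec L) :
    gaussianChannel μ c l r x = μ.withDensity fun y =>
      ENNReal.ofReal (Real.exp (couplingLogDensity c l r (x, y))) := by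
  rw [gaussianChannel, Kernel.withDensity_apply, Kernel.const_apply]
  exact (measurable_couplingLogDensity hc).exp.ennreal_ofReal

lemma measurePreserving_gaussianChannel
    (hc : MeasurePreserving c μ (Measure.pi fun i => gaussianReal 0 (l i).toNNReal))
    (hl : ∀ i, 0 < l i) (hr : ∀ i, 0 < 1 - r i ^ 2) (x : Vec L) :
    MeasurePreserving c (gaussianChannel μ c l r x)
      (Measure.pi fun i => gaussianReal (r i * c x i) (l i * (1 - r i ^ 2)).toNNReal) := by
  refine ⟨hc.measurable, ?_⟩
  have h := pi_withDensity_prod (μ := fun i => gaussianReal 0 (l i).toNNReal)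
    (g := fun i y => Real.exp (gaussianLogCopula (l i) (r i) (c x i) y))
    (fun i y => (Real.exp_pos _).le) fun i => integrable_exp_gaussianLogCopula (hl i) (hr i) _
  simp_rw [gaussianReal_withDensity_gaussianLogCopula (hl _) (hr _)] at h
  rw [← h, gaussianChannel_apply hc.measurable]
  ext s hs
  rw [Measure.map_apply hc.measurable hs, withDensity_apply _ (hc.measurable hs),
    withDensity_apply _ hs, ← hc.setLIntegral_comp_preimage hs]
  · simp_rw [couplingLogDensity, Real.exp_sum]
  · have (i : Fin L) : Measurable fun y : Fin L → ℝ =>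
        gaussianLogCopula (l i) (r i) (c x i) (y i) :=
      (measurable_gaussianLogCopula_right _ _ _).comp (measurable_pi_apply i)
    exact (Finset.measurable_fun_prod _ fun i _ => (this i).exp).ennreal_ofReal

lemma isMarkovKernel_gaussianChannel
    (hc : MeasurePreserving c μ (Measure.pi fun i => gaussianReal 0 (l i).toNNReal))
    (hl : ∀ i, 0 < l i) (hr : ∀ i, 0 < 1 - r i ^ 2) :
    IsMarkovKernel (gaussianChannel μ c l r) := by
  refine ⟨fun x => ⟨?_⟩⟩
  have h := (measurePreserving_gaussianChannel hc hl hr x).measure_preimage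
    MeasurableSet.univ.nullMeasurableSet
  rwa [Set.preimage_univ, measure_univ (μ := Measure.pi _)] at h

lemma compProd_gaussianChannel
    (hc : MeasurePreserving c μ (Measure.pi fun i => gaussianReal 0 (l i).toNNReal))
    (hl : ∀ i, 0 < l i) (hr : ∀ i, 0 < 1 - r i ^ 2) :
    μ ⊗ₘ gaussianChannel μ c l r = (μ.prod μ).withDensity fun p =>
      ENNReal.ofReal (Real.exp (couplingLogDensity c l r p)) := by
  have := isMarkovKernel_gaussianChannel hc hl hr
  unfold gaussianChannel at *
  rw [Measure.compProd_withDensity, Measure.compProd_const]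
  exact (measurable_couplingLogDensity hc.measurable).exp.ennreal_ofReal

lemma integrable_exp_couplingLogDensity
    (hc : MeasurePreserving c μ (Measure.pi fun i => gaussianReal 0 (l i).toNNReal))
    (hl : ∀ i, 0 < l i) (hr : ∀ i, 0 < 1 - r i ^ 2) :
    Integrable (fun p => Real.exp (couplingLogDensity c l r p)) (μ.prod μ) ∧
      ∫ p, Real.exp (couplingLogDensity c l r p) ∂(μ.prod μ) = 1 := by
  have := isMarkovKernel_gaussianChannel hc hl hr
  have hmeas : Measurable (fun p => Real.exp (couplingLogDensity c l r p)) :=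
    (measurable_couplingLogDensity hc.measurable).exp
  have hone : ∫⁻ p, ENNReal.ofReal (Real.exp (couplingLogDensity c l r p)) ∂(μ.prod μ) = 1 := by
    rw [← setLIntegral_univ, ← withDensity_apply _ MeasurableSet.univ,
      ← compProd_gaussianChannel hc hl hr, measure_univ]
  have hpos : 0 ≤ᵐ[μ.prod μ] fun p => Real.exp (couplingLogDensity c l r p) :=
    Filter.Eventually.of_forall fun p => (Real.exp_pos _).le
  refine ⟨(lintegral_ofReal_ne_top_iff_integrable hmeas.aestronglyMeasurable hpos).1 (by simp [hone]),
    ?_⟩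
  rw [integral_eq_lintegral_of_nonneg_ae hpos hmeas.aestronglyMeasurable, hone, ENNReal.toReal_one]

lemma compProd_gaussianChannel_eq_tilted
    (hc : MeasurePreserving c μ (Measure.pi fun i => gaussianReal 0 (l i).toNNReal))
    (hl : ∀ i, 0 < l i) (hr : ∀ i, 0 < 1 - r i ^ 2) :
    μ ⊗ₘ gaussianChannel μ c l r = (μ.prod μ).tilted (couplingLogDensity c l r) := by
  rw [compProd_gaussianChannel hc hl hr, Measure.tilted,
    (integrable_exp_couplingLogDensity hc hl hr).2]
  simp

/-- The joint density is symmetric in its two arguments, so integrating out the input gives the same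
constant `1` as integrating out the output. -/
lemma reconLaw_gaussianChannel
    (hc : MeasurePreserving c μ (Measure.pi fun i => gaussianReal 0 (l i).toNNReal))
    (hl : ∀ i, 0 < l i) (hr : ∀ i, 0 < 1 - r i ^ 2) :
    reconLaw μ (gaussianChannel μ c l r) = μ := by
  have hmk := isMarkovKernel_gaussianChannel hc hl hr
  have hmeas := (measurable_couplingLogDensity (l := l) (r := r) hc.measurable).exp.ennreal_ofReal
  rw [reconLaw, compProd_gaussianChannel hc hl hr]
  ext s hs
  rw [Measure.snd_apply hs, withDensity_apply _ (measurable_snd hs), ← Set.univ_prod,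
    ← Measure.prod_restrict, Measure.restrict_univ, lintegral_prod_symm _ hmeas.aemeasurable]
  have h (y : Vec L) :
      ∫⁻ x, ENNReal.ofReal (Real.exp (couplingLogDensity c l r (x, y))) ∂μ = 1 := by
    simp_rw [couplingLogDensity_comm _ y]
    rw [← setLIntegral_univ, ← withDensity_apply _ MeasurableSet.univ,
      ← gaussianChannel_apply hc.measurable, measure_univ]
  simp [h]

lemma lt_one_of_one_sub_sq_pos {a : ℝ} (h : 0 < 1 - a ^ 2) : a < 1 := by
  nlinarith

/-- Per component, the conditional error given `x` is the variance `l (1 - r²)` plus the squared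
bias `(1 - r)² x²`; averaging over `x` gives `2 l - 2 l r`. -/
lemma meanSquaredError_gaussianChannel
    (hc : MeasurePreserving c μ (Measure.pi fun i => gaussianReal 0 (l i).toNNReal))
    (hnorm : ∀ x y, ‖x - y‖ ^ 2 = ∑ i, (c x i - c y i) ^ 2)
    (hl : ∀ i, 0 < l i) (hr : ∀ i, 0 < 1 - r i ^ 2) :
    meanSquaredError (μ ⊗ₘ gaussianChannel μ c l r)
      = ENNReal.ofReal (∑ i, (2 * l i - 2 * (l i * r i))) := by
  have hmk := isMarkovKernel_gaussianChannel hc hl hr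
  have hci (i : Fin L) : Measurable fun x => c x i := (measurable_pi_apply i).comp hc.measurable
  have hv (i : Fin L) : 0 < l i * (1 - r i ^ 2) := mul_pos (hl i) (hr i)
  have hinner (x : Vec L) : ∫⁻ y, ENNReal.ofReal (‖x - y‖ ^ 2) ∂(gaussianChannel μ c l r x)
      = ∑ i, ENNReal.ofReal (l i * (1 - r i ^ 2) + (c x i - r i * c x i) ^ 2) := by
    simp_rw [hnorm, ENNReal.ofReal_sum_of_nonneg fun i _ => sq_nonneg (c x i - c _ i)]
    rw [lintegral_finsetSum]
    · refine Finset.sum_congr rfl fun i _ => ?_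
      have hmp := (measurePreserving_eval _ i).comp
        (measurePreserving_gaussianChannel hc hl hr x)
      have h := hmp.lintegral_comp (f := fun t => ENNReal.ofReal ((c x i - t) ^ 2)) (by fun_prop)
      rw [lintegral_sub_sq_gaussianReal, Real.coe_toNNReal _ (hv i).le] at h
      exact h
    · intro i _
      have := hci i
      fun_prop
  rw [meanSquaredError, Measure.lintegral_compProd (by fun_prop)]
  simp_rw [hinner]
  rw [lintegral_finsetSum]
  · rw [ENNReal.ofReal_sum_of_nonneg]
    · refine Finset.sum_congr rfl fun i _ => ?_
      have hmp := (measurePreserving_eval _ i).comp hc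
      have h := hmp.lintegral_comp
        (f := fun t => ENNReal.ofReal (l i * (1 - r i ^ 2) + (t - r i * t) ^ 2)) (by fun_prop)
      refine Eq.trans h ?_
      have hint := integrable_sq_gaussianReal 0 (l i).toNNReal
      have heq : (fun t : ℝ => l i * (1 - r i ^ 2) + (t - r i * t) ^ 2)
          = fun t => l i * (1 - r i ^ 2) + (1 - r i) ^ 2 * t ^ 2 := by funext t; ring
      have hpos : ∀ t : ℝ, 0 ≤ l i * (1 - r i ^ 2) + (1 - r i) ^ 2 * t ^ 2 := fun t => by
        have := (hv i).le
        positivity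
      have hcalc : ∫ t, (l i * (1 - r i ^ 2) + (1 - r i) ^ 2 * t ^ 2)
          ∂(gaussianReal 0 (l i).toNNReal) = 2 * l i - 2 * (l i * r i) := by
        rw [integral_add (integrable_const _) (hint.const_mul _),
          integral_const_mul ((1 - r i) ^ 2) (fun t : ℝ => t ^ 2),
          integral_sq_gaussianReal_zero (hl i)]
        simp
        ring
      have hint' : Integrable (fun t : ℝ => l i * (1 - r i ^ 2) + (1 - r i) ^ 2 * t ^ 2)
          (gaussianReal 0 (l i).toNNReal) := (integrable_const _).add (hint.const_mul _)
      rw [← hcalc, ofReal_integral_eq_lintegral_ofReal hint' (Filter.Eventually.of_forall hpos)]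
      simp_rw [fun t => congrFun heq t]
    · intro i _
      nlinarith [hl i, lt_one_of_one_sub_sq_pos (hr i)]
  · intro i _
    have := hci i
    fun_prop

/-- The stationarity condition turns the coefficient of `x y` into `2 ν`, independent of the
component. Summed over components, the cross terms therefore assemble into the squared distance. -/
lemma gaussianLogCopula_eq {ν l r : ℝ} (hl : 0 < l) (hr : 0 < 1 - r ^ 2)
    (hν : r = 2 * ν * l * (1 - r ^ 2)) (x y : ℝ) :
    gaussianLogCopula l r x y
      = -(Real.log (1 - r ^ 2) / 2) + ν * (1 - r) * (x ^ 2 + y ^ 2) - ν * (x - y) ^ 2 := by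
  have hν' : ν = r / (2 * l * (1 - r ^ 2)) := by
    rw [eq_div_iff (by positivity)]; linarith
  rw [gaussianLogCopula, hν']
  field_simp
  ring

/-- Since both marginals of `π` are `μ`, the second moments of the coordinates are the `l i`, and
only the squared distance still depends on the coupling. -/
lemma integral_couplingLogDensity {ν : ℝ}
    (hc : MeasurePreserving c μ (Measure.pi fun i => gaussianReal 0 (l i).toNNReal))
    (hnorm : ∀ x y, ‖x - y‖ ^ 2 = ∑ i, (c x i - c y i) ^ 2)
    (hl : ∀ i, 0 < l i) (hr : ∀ i, 0 < 1 - r i ^ 2)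
    (hν : ∀ i, r i = 2 * ν * l i * (1 - r i ^ 2))
    {π : Measure (Vec L × Vec L)} (h1 : π.fst = μ) (h2 : π.snd = μ)
    (hπ : Integrable (fun p : Vec L × Vec L => ‖p.1 - p.2‖ ^ 2) π) :
    Integrable (couplingLogDensity c l r) π ∧
      ∫ p, couplingLogDensity c l r p ∂π
        = -(1 / 2) * ∑ i, Real.log (1 - r i ^ 2)
          + ν * (∑ i, (2 * l i - 2 * (l i * r i)) - ∫ p, ‖p.1 - p.2‖ ^ 2 ∂π) := by
  have hprob : IsProbabilityMeasure π := ⟨by rw [← Measure.fst_univ, h1, measure_univ]⟩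
  have hF : couplingLogDensity c l r = fun p =>
      ∑ i, (-(Real.log (1 - r i ^ 2) / 2) + ν * (1 - r i) * (c p.1 i ^ 2 + c p.2 i ^ 2))
        - ν * ‖p.1 - p.2‖ ^ 2 := by
    funext p
    rw [hnorm, Finset.mul_sum, ← Finset.sum_sub_distrib]
    exact Finset.sum_congr rfl fun i _ => gaussianLogCopula_eq (hl i) (hr i) (hν i) _ _
  have hmoment (g : Vec L × Vec L → Vec L) (hg : MeasurePreserving g π μ) (i : Fin L) :
      Integrable (fun p => c (g p) i ^ 2) π ∧ ∫ p, c (g p) i ^ 2 ∂π = l i := by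
    have hmp := ((measurePreserving_eval _ i).comp hc).comp hg
    refine ⟨hmp.integrable_comp_of_integrable (integrable_sq_gaussianReal 0 (l i).toNNReal), ?_⟩
    have h := integral_map (μ := π) (f := fun t : ℝ => t ^ 2) hmp.measurable.aemeasurable
      (by fun_prop)
    rw [hmp.map_eq, integral_sq_gaussianReal_zero (hl i)] at h
    simpa using h.symm
  have hm1 := hmoment Prod.fst ⟨measurable_fst, h1⟩
  have hm2 := hmoment Prod.snd ⟨measurable_snd, h2⟩
  have hadd (i : Fin L) : Integrable (fun p : Vec L × Vec L => c p.1 i ^ 2 + c p.2 i ^ 2) π :=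
    (hm1 i).1.add (hm2 i).1
  have hterm (i : Fin L) : Integrable (fun p : Vec L × Vec L =>
      -(Real.log (1 - r i ^ 2) / 2) + ν * (1 - r i) * (c p.1 i ^ 2 + c p.2 i ^ 2)) π :=
    (integrable_const _).add ((hadd i).const_mul _)
  have hsum : Integrable (fun p : Vec L × Vec L =>
      ∑ i, (-(Real.log (1 - r i ^ 2) / 2) + ν * (1 - r i) * (c p.1 i ^ 2 + c p.2 i ^ 2))) π :=
    integrable_finsetSum _ fun i _ => hterm i
  rw [hF]
  refine ⟨hsum.sub (hπ.const_mul ν), ?_⟩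
  rw [integral_sub hsum (hπ.const_mul ν), integral_finsetSum _ fun i _ => hterm i,
    integral_const_mul, mul_sub, ← add_sub_assoc, Finset.mul_sum, Finset.mul_sum,
    ← Finset.sum_add_distrib]
  congr 1
  refine Finset.sum_congr rfl fun i _ => ?_
  rw [integral_add (integrable_const _) ((hadd i).const_mul _),
    integral_const_mul, integral_add (hm1 i).1 (hm2 i).1, (hm1 i).2, (hm2 i).2]
  simp
  ring

end Channel

/-! ### The rate-distortion-perception function at `P = 0` -/

lemma rdpFunction_zero_eq {L : ℕ} {φ : Measure (Vec L) → Measure (Vec L) → ℝ≥0∞}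
    (hφ : ∀ μ ν : Measure (Vec L), IsProbabilityMeasure μ → IsProbabilityMeasure ν →
      (φ μ ν = 0 ↔ ν = μ))
    {μ : Measure (Vec L)} [IsProbabilityMeasure μ] {c : Vec L → Fin L → ℝ} {l r : Fin L → ℝ} {ν : ℝ}
    (hc : MeasurePreserving c μ (Measure.pi fun i => gaussianReal 0 (l i).toNNReal))
    (hnorm : ∀ x y, ‖x - y‖ ^ 2 = ∑ i, (c x i - c y i) ^ 2)
    (hl : ∀ i, 0 < l i) (hr : ∀ i, 0 < 1 - r i ^ 2) (hν0 : 0 ≤ ν)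
    (hν : ∀ i, r i = 2 * ν * l i * (1 - r i ^ 2)) :
    rdpFunction φ μ (ENNReal.ofReal (∑ i, (2 * l i - 2 * (l i * r i)))) 0
      = ENNReal.ofReal (-(1 / 2) * ∑ i, Real.log (1 - r i ^ 2)) := by
  set D := ∑ i, (2 * l i - 2 * (l i * r i)) with hDdef
  have hD : 0 ≤ D := Finset.sum_nonneg fun i _ => by
    nlinarith [hl i, lt_one_of_one_sub_sq_pos (hr i)]
  obtain ⟨hexp, hone⟩ := integrable_exp_couplingLogDensity hc hl hr
  refine le_antisymm ?_ (le_iInf fun κ => le_iInf fun hκ => le_iInf fun hmse => le_iInf fun hper => ?_)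
  · have hmk := isMarkovKernel_gaussianChannel hc hl hr
    have hmse := meanSquaredError_gaussianChannel hc hnorm hl hr
    have hrecon := reconLaw_gaussianChannel hc hl hr
    have hint := meanSquaredError_ne_top_integrable (hmse.trans_lt ENNReal.ofReal_lt_top).ne
    obtain ⟨hF, hFint⟩ := integral_couplingLogDensity hc hnorm hl hr hν
      (Measure.fst_compProd μ _) hrecon hint
    have hE : ∫ p, ‖p.1 - p.2‖ ^ 2 ∂(μ ⊗ₘ gaussianChannel μ c l r) = D := by
      rw [integral_eq_lintegral_of_nonneg_ae (Filter.Eventually.of_forall fun p => by positivity)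
        (by fun_prop)]
      change (meanSquaredError _).toReal = D
      rw [hmse, ENNReal.toReal_ofReal hD]
    refine (iInf_le _ (gaussianChannel μ c l r)).trans ((iInf_le _ hmk).trans
      ((iInf_le _ hmse.le).trans ((iInf_le _ ?_).trans (le_of_eq ?_))))
    · rw [hrecon]
      exact ((hφ μ μ inferInstance inferInstance).2 rfl).le
    · rw [mutualInformation, hrecon]
      -- The Gaussian channel meets the distortion constraint with equality, so the `ν` term
      -- vanishes.
      rw [hE, ← hDdef, sub_self, mul_zero, add_zero] at hFint
      rw [compProd_gaussianChannel_eq_tilted hc hl hr] at hF hFint ⊢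
      rw [klDiv_tilted_left hF hexp hone, hFint]
  · have hprob : IsProbabilityMeasure (reconLaw μ κ) := by unfold reconLaw; infer_instance
    have hrecon := (hφ μ _ inferInstance hprob).1 (nonpos_iff_eq_zero.1 hper)
    have hint := meanSquaredError_ne_top_integrable (hmse.trans_lt ENNReal.ofReal_lt_top).ne
    have hle := integral_le_of_meanSquaredError_le hD hmse
    obtain ⟨hF, hFint⟩ := integral_couplingLogDensity hc hnorm hl hr hν
      (Measure.fst_compProd μ κ) hrecon hint
    rw [mutualInformation, hrecon]
    refine le_trans (ENNReal.ofReal_le_ofReal ?_) (ofReal_integral_le_klDiv hF hexp hone)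
    rw [hFint]
    -- Unused distortion only raises the lower bound, because the multiplier is nonnegative.
    have := mul_nonneg hν0 (sub_nonneg.2 hle)
    linarith

theorem corollary1 {L : ℕ} (S Θ : Matrix (Fin L) (Fin L) ℝ) (l : Fin L → ℝ)
    (hS : S.PosDef) (hΘ : Θ ∈ Matrix.orthogonalGroup (Fin L) ℝ)
    (hdec : S = Θ.transpose * Matrix.diagonal l * Θ)
    (D : ℝ) (hD0 : 0 < D) (hD : D < 2 * ∑ i, l i) :
    (∃ ν₁ : ℝ, 0 < ν₁ ∧ D = ∑ i, (2 * l i - 2 * √(l i * (l i - waterLevel ν₁ (l i))))) ∧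
    ∀ ν₁ : ℝ, 0 < ν₁ →
      D = ∑ i, (2 * l i - 2 * √(l i * (l i - waterLevel ν₁ (l i)))) →
      (rdpFunction klPerception (multivariateGaussian 0 S) (ENNReal.ofReal D) 0 =
          ENNReal.ofReal
            ((1 / 2) * ∑ i, Real.log ((1 + √(1 + 16 * ν₁ ^ 2 * l i ^ 2)) / 2)) ∧
        programOptimal componentKL l D 0 = {(fun i => waterLevel ν₁ (l i), l)}) ∧
      (rdpFunction wassersteinPerception (multivariateGaussian 0 S) (ENNReal.ofReal D) 0 =
          ENNReal.ofReal
            ((1 / 2) * ∑ i, Real.log ((1 + √(1 + 16 * ν₁ ^ 2 * l i ^ 2)) / 2)) ∧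
        programOptimal componentW2 l D 0 = {(fun i => waterLevel ν₁ (l i), l)}) := by
  have hl := posDef_conj_diagonal_pos hS hΘ hdec
  refine ⟨exists_distortion_eq hl hD0 hD, fun ν hν hDν => ?_⟩
  have hc := measurePreserving_mulVec_multivariateGaussian hS hΘ hdec
  have hnorm (x y : Vec L) :
      ‖x - y‖ ^ 2 = ∑ i, (Θ.mulVec x.ofLp i - Θ.mulVec y.ofLp i) ^ 2 := by
    rw [norm_sq_eq_sum_mulVec hΘ]
    simp [Matrix.mulVec_sub]
  have hD' : D = ∑ i, (2 * l i - 2 * (l i * waterCorr ν (l i))) := by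
    simp_rw [hDν, sqrt_mul_sub_waterLevel (hl _)]
  have hrate : (1 / 2) * ∑ i, Real.log ((1 + √(1 + 16 * ν ^ 2 * l i ^ 2)) / 2)
      = -(1 / 2) * ∑ i, Real.log (1 - waterCorr ν (l i) ^ 2) := by
    simp_rw [log_rate_eq hν (hl _), Finset.sum_neg_distrib]
    ring
  have key {φ : Measure (Vec L) → Measure (Vec L) → ℝ≥0∞}
      (hφ : ∀ μ ν : Measure (Vec L), IsProbabilityMeasure μ → IsProbabilityMeasure ν →
        (φ μ ν = 0 ↔ ν = μ)) :
      rdpFunction φ (multivariateGaussian 0 S) (ENNReal.ofReal D) 0 = ENNReal.ofReal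
        ((1 / 2) * ∑ i, Real.log ((1 + √(1 + 16 * ν ^ 2 * l i ^ 2)) / 2)) := by
    rw [hrate, hD']
    exact rdpFunction_zero_eq hφ hc hnorm hl (fun i => one_sub_waterCorr_sq_pos hν (hl i)) hν.le
      fun i => waterCorr_eq hν (hl i)
  exact ⟨⟨key fun _ _ _ _ => klPerception_eq_zero_iff,
      programOptimal_zero hl (fun i _ h => componentKL_eq_zero_iff (hl i) h) hν hDν⟩,
    ⟨key fun _ _ _ _ => wassersteinPerception_eq_zero_iff,
      programOptimal_zero hl (fun i _ h => componentW2_eq_zero_iff (hl i) h) hν hDν⟩⟩
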